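/- Let $k$ be a field of characteristic $0$ and let $k_J[x_1,x_2]=k\langle x_1,x_2\rangle/(x_2x_1-x_1x_2-x_1^2)$ be the Jordan plane. Let $K$ be a finite-dimensional Hopf algebra over $k$ (not assumed semisimple) that coacts on $k_J[x_1,x_2]$ from the right, i.e. there is an algebra homomorphism $\rho:k_J[x_1,x_2]\to k_J[x_1,x_2]\otimes K$ that is a right $K$-comodule structure. Suppose that the coaction preserves the grading, i.e. $\rho(x_i)=x_1\otimes a_{1i}+x_2\otimes a_{2i}$ for $i=1,2$ with some $a_{si}\in K$, and that it is inner-faithful, i.e. $\rho(k_J[x_1,x_2])\not\subset k_J[x_1,x_2]\otimes K'$ for every proper Hopf subalgebra $K'\subsetneq K$. Then $K$ is isomorphic as a Hopf algebra to the group algebra $kC_n$ of the cyclic group $C_n$ of order $n$, for some $n\ge 1$. -/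

import Mathlib

open scoped TensorProduct

/-- The defining relation `x₂x₁ = x₁x₂ + x₁²` of the Jordan plane, on the free algebra in
`x₁ = ι 0` and `x₂ = ι 1`. -/
inductive JordanPlaneRel (k : Type*) [Field k] :
    FreeAlgebra k (Fin 2) → FreeAlgebra k (Fin 2) → Prop
  | rel : JordanPlaneRel k
      (FreeAlgebra.ι k 1 * FreeAlgebra.ι k 0)
      (FreeAlgebra.ι k 0 * FreeAlgebra.ι k 1 + FreeAlgebra.ι k 0 ^ 2)

/-- The Jordan plane `k_J[x₁, x₂] = k⟨x₁, x₂⟩ / (x₂x₁ - x₁x₂ - x₁²)`. -/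
abbrev JordanPlane (k : Type*) [Field k] : Type _ := RingQuot (JordanPlaneRel k)

/-- The generators of the Jordan plane: `x₁` is `JordanPlane.gen k 0` and `x₂` is
`JordanPlane.gen k 1`. -/
noncomputable def JordanPlane.gen (k : Type*) [Field k] (i : Fin 2) : JordanPlane k :=
  RingQuot.mkAlgHom k (JordanPlaneRel k) (FreeAlgebra.ι k i)

/-- `ρ : N → N ⊗ K` is a right `K`-comodule structure on the vector space `N`. -/
structure IsRightCoaction {k N K : Type*} [Field k] [AddCommGroup N] [Module k N]
    [Ring K] [HopfAlgebra k K] (ρ : N →ₗ[k] N ⊗[k] K) : Prop where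
  /-- `(ρ ⊗ id) ∘ ρ = (id ⊗ Δ) ∘ ρ`. -/
  coassoc : ∀ v : N, TensorProduct.assoc k N K K (ρ.rTensor K (ρ v)) =
    (Coalgebra.comul (R := k) (A := K)).lTensor N (ρ v)
  /-- `(id ⊗ ε) ∘ ρ = id`. -/
  counit : ∀ v : N,
    TensorProduct.rid k N ((Coalgebra.counit (R := k) (A := K)).lTensor N (ρ v)) = v

/-- The algebra map `ρ : A → A ⊗ K` makes `A` a right `K`-comodule algebra, that is, the Hopf
algebra `K` coacts on the algebra `A` from the right. -/
def IsRightComoduleAlgebra {k A K : Type*} [Field k] [Ring A] [Algebra k A]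
    [Ring K] [HopfAlgebra k K] (ρ : A →ₐ[k] A ⊗[k] K) : Prop :=
  IsRightCoaction ρ.toLinearMap

/-- The subalgebra `B` of `K` is a Hopf subalgebra: `Δ(B) ⊆ B ⊗ B` and `S(B) ⊆ B`. Here `B ⊗ B`
is the image of the canonical (injective, as `k` is a field) map `B ⊗ B → K ⊗ K`. -/
structure IsHopfSubalgebra {k K : Type*} [Field k] [Ring K] [HopfAlgebra k K]
    (B : Subalgebra k K) : Prop where
  comul_mem : ∀ b ∈ B, Coalgebra.comul (R := k) b ∈
    LinearMap.range (TensorProduct.map B.val.toLinearMap B.val.toLinearMap)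
  antipode_mem : ∀ b ∈ B, HopfAlgebra.antipode k b ∈ B

/-- The coaction `ρ : N → N ⊗ K` is inner-faithful: `ρ(N) ⊄ N ⊗ B` for every proper Hopf
subalgebra `B` of `K`. -/
def IsInnerFaithfulCoaction {k N K : Type*} [Field k] [AddCommGroup N] [Module k N]
    [Ring K] [HopfAlgebra k K] (ρ : N →ₗ[k] N ⊗[k] K) : Prop :=
  ∀ B : Subalgebra k K, IsHopfSubalgebra B → B ≠ ⊤ →
    ¬ LinearMap.range ρ ≤ LinearMap.range (B.val.toLinearMap.lTensor N)

/-! The plan is to show that the comatrix `!![a, b; c, d]` of the coaction is scalar: `b = c = 0`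
and `d = a`. Then `a` is group-like, inner-faithfulness forces it to generate `K`, and finite
dimension makes `K` the group algebra of a finite cyclic group.

Inverting `x₁` turns the Jordan plane into skew Laurent polynomials over `k[X]`. Hence degree `d` is
identified, through `symbol`, with polynomials of degree at most `d`, and the product of symbols is
`f(X) g(X - d)`. The square of the antipode, conjugated by the quantum determinant, is an algebra
map which intertwines the coaction with `X ↦ X + 2` (`exists_algHom`, `shear_coaction`).

With `m = dim K`, the symbols in `k[X] ⊗ K` of the coaction on `1, X, …, X ^ m` are
`k[X]`-dependent. Their relations form a submodule of `k[X][Y]` stable under `X ↦ X + 2`, `Y ↦ Y +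
2`. In characteristic `0` an element of least `Y`-degree can then be taken monic, with subleading
coefficient of degree exactly one in `X` (`exists_monic_generator`).

Relations are also stable under the dual of `K` acting on their coefficients
(`sum_sliceRight_mul_eq_zero`). As the minimal relation is unique up to a factor, its homogenized
coefficients are semi-invariants of one weight `g` (`exists_semiinvariant`). Among their
combinations are `x₁ ^ l` and `(x₂ + x₁) x₁ ^ (l - 1)`. Their ratio is thus fixed, and comparing
coefficients makes the comatrix scalar (`comatrix_eq_scalar`). -/

section

open Polynomial

namespace JordanPlane

/-! ### Generators and relation of the Jordan plane. -/

section Presentation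

variable {k : Type*} [Field k]

theorem gen_one_mul_gen_zero :
    gen k 1 * gen k 0 = gen k 0 * gen k 1 + gen k 0 ^ 2 := by
  have h := RingQuot.mkAlgHom_rel k (JordanPlaneRel.rel (k := k))
  simp only [map_mul, map_add, map_pow] at h
  exact h

/-- The algebra map out of the Jordan plane given by a pair satisfying its relation. -/
noncomputable def lift {B : Type*} [Ring B] [Algebra k B] (X Y : B)
    (h : Y * X = X * Y + X ^ 2) : JordanPlane k →ₐ[k] B :=
  RingQuot.liftAlgHom k ⟨FreeAlgebra.lift k ![X, Y], by
    rintro _ _ ⟨⟩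
    simpa using h⟩

@[simp]
theorem lift_gen_zero {B : Type*} [Ring B] [Algebra k B] (X Y : B)
    (h : Y * X = X * Y + X ^ 2) : lift (k := k) X Y h (gen k 0) = X := by
  simp [lift, gen]

@[simp]
theorem lift_gen_one {B : Type*} [Ring B] [Algebra k B] (X Y : B)
    (h : Y * X = X * Y + X ^ 2) : lift (k := k) X Y h (gen k 1) = Y := by
  simp [lift, gen]

theorem algHom_ext {B : Type*} [Semiring B] [Algebra k B] {f g : JordanPlane k →ₐ[k] B}
    (h0 : f (gen k 0) = g (gen k 0)) (h1 : f (gen k 1) = g (gen k 1)) : f = g := by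
  apply RingQuot.ringQuot_ext'
  apply FreeAlgebra.hom_ext
  funext i
  fin_cases i
  · simpa [gen] using h0
  · simpa [gen] using h1

@[elab_as_elim]
theorem induction {P : JordanPlane k → Prop} (u : JordanPlane k)
    (algebraMap : ∀ r : k, P (algebraMap k _ r)) (gen : ∀ i, P (gen k i))
    (add : ∀ u v, P u → P v → P (u + v)) (mul : ∀ u v, P u → P v → P (u * v)) : P u := by
  obtain ⟨u, rfl⟩ := RingQuot.mkAlgHom_surjective k (JordanPlaneRel k) u
  induction u using FreeAlgebra.induction with
  | grade0 r => simpa using algebraMap r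
  | grade1 i => exact gen i
  | mul a b ha hb => simpa using mul _ _ ha hb
  | add a b ha hb => simpa using add _ _ ha hb

theorem gen_zero_pow_mul_gen_one (n : ℕ) :
    gen k 0 ^ n * gen k 1 = gen k 1 * gen k 0 ^ n - (n : k) • gen k 0 ^ (n + 1) := by
  induction n with
  | zero => simp
  | succ n ih =>
    have h : gen k 0 * gen k 1 = gen k 1 * gen k 0 - gen k 0 ^ 2 := by
      rw [gen_one_mul_gen_zero]; abel
    rw [pow_succ', mul_assoc, ih, mul_sub, ← mul_assoc, h, sub_mul, mul_smul_comm, mul_assoc,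
      ← pow_succ', ← pow_succ', ← pow_add, Nat.cast_succ, add_smul, one_smul,
      show 2 + n = n + 1 + 1 by ring]
    abel

end Presentation

/-! ### Symbols: each degree as a space of polynomials. -/

section Symbol

variable (k : Type*) [Field k]

/-- The action of the Jordan plane on `k[X]` in which `x₁` is the shift `h(X) ↦ h(X - 1)` and
`x₂` is the shift followed by multiplication by `X - 1`. -/
noncomputable def shiftRep : JordanPlane k →ₐ[k] Module.End k k[X] :=
  lift (taylor (-1 : k)) (LinearMap.mulLeft k (X - 1 : k[X]) * taylor (-1 : k)) (by
    ext n : 2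
    simp [pow_two, sub_eq_add_neg, add_mul])

@[simp]
theorem shiftRep_gen_zero (h : k[X]) : shiftRep k (gen k 0) h = taylor (-1) h := by
  simp [shiftRep]

@[simp]
theorem shiftRep_gen_one (h : k[X]) :
    shiftRep k (gen k 1) h = (X - 1) * taylor (-1) h := by
  simp [shiftRep]

/-- The value at `1` of the action of the Jordan plane on `k[X]`. -/
noncomputable def symbol : JordanPlane k →ₗ[k] k[X] :=
  (LinearMap.applyₗ (1 : k[X])) ∘ₗ (shiftRep k).toLinearMap

theorem symbol_apply (u : JordanPlane k) : symbol k u = shiftRep k u 1 := rfl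

theorem symbol_mul_eq_shiftRep (u v : JordanPlane k) :
    symbol k (u * v) = shiftRep k u (symbol k v) := by
  simp [symbol_apply]

/-- A homogeneous element of degree `i` whose symbol is `X ^ i`. -/
noncomputable def powElem : ℕ → JordanPlane k
  | 0 => 1
  -- The last factor has symbol `X + i`; the shift by `-i` coming from the degree of `powElem i`
  -- turns it into `X`.
  | i + 1 => powElem i * (gen k 1 + ((i : k) + 1) • gen k 0)

theorem shiftRep_powElem (i : ℕ) (h : k[X]) :
    shiftRep k (powElem k i) h = X ^ i * taylor (-(i : k)) h := by
  induction i generalizing h with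
  | zero => simp [powElem]
  | succ i ih =>
    simp only [powElem, map_mul, Module.End.mul_apply, map_add, map_smul, LinearMap.add_apply,
      LinearMap.smul_apply, shiftRep_gen_zero, shiftRep_gen_one, ih, taylor_mul, taylor_taylor,
      taylor_X, map_sub, smul_eq_C_mul, taylor_C, taylor_one]
    rw [show -((i + 1 : ℕ) : k) = -(i : k) + -1 by push_cast; ring]
    simp only [map_neg, map_natCast, map_one]
    ring

theorem shiftRep_gen_zero_pow (j : ℕ) (h : k[X]) :
    shiftRep k (gen k 0 ^ j) h = taylor (-(j : k)) h := by
  induction j generalizing h with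
  | zero => simp
  | succ j ih =>
    rw [pow_succ, map_mul, Module.End.mul_apply, shiftRep_gen_zero, ih, taylor_taylor]
    congr 2
    push_cast; ring

theorem shiftRep_powElem_mul (i j : ℕ) (h : k[X]) :
    shiftRep k (powElem k i * gen k 0 ^ j) h = X ^ i * taylor (-((i + j : ℕ) : k)) h := by
  rw [map_mul, Module.End.mul_apply, shiftRep_powElem, shiftRep_gen_zero_pow, taylor_taylor]
  congr 3
  push_cast; ring

theorem symbol_powElem_mul (i j : ℕ) :
    symbol k (powElem k i * gen k 0 ^ j) = X ^ i := by
  rw [symbol_apply, shiftRep_powElem_mul, taylor_one, C_1, mul_one]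

/-- The homogeneous component of degree `d` of the Jordan plane. -/
noncomputable def homogeneous (d : ℕ) : Submodule k (JordanPlane k) :=
  Submodule.span k {u | ∃ i j, i + j = d ∧ u = powElem k i * gen k 0 ^ j}

variable {k}

theorem powElem_mul_mem (i j : ℕ) : powElem k i * gen k 0 ^ j ∈ homogeneous k (i + j) :=
  Submodule.subset_span ⟨i, j, rfl, rfl⟩

theorem mul_gen_zero_mem {d : ℕ} {u : JordanPlane k} (hu : u ∈ homogeneous k d) :
    u * gen k 0 ∈ homogeneous k (d + 1) := by
  induction hu using Submodule.span_induction with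
  | mem u hu =>
    obtain ⟨i, j, rfl, rfl⟩ := hu
    rw [mul_assoc, ← pow_succ]
    exact powElem_mul_mem i (j + 1)
  | zero => simp
  | add u v _ _ hu hv => rw [add_mul]; exact add_mem hu hv
  | smul r u _ hu => rw [smul_mul_assoc]; exact Submodule.smul_mem _ _ hu

theorem powElem_mul_gen_one (i j : ℕ) :
    powElem k i * gen k 0 ^ j * gen k 1 =
      powElem k (i + 1) * gen k 0 ^ j
        - ((i + j : ℕ) + 1 : k) • (powElem k i * gen k 0 ^ (j + 1)) := by
  rw [mul_assoc, gen_zero_pow_mul_gen_one, powElem]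
  simp only [mul_sub, mul_add, add_mul, mul_assoc, mul_smul_comm, smul_mul_assoc, ← pow_succ']
  push_cast
  module

theorem mul_gen_one_mem {d : ℕ} {u : JordanPlane k} (hu : u ∈ homogeneous k d) :
    u * gen k 1 ∈ homogeneous k (d + 1) := by
  induction hu using Submodule.span_induction with
  | mem u hu =>
    obtain ⟨i, j, rfl, rfl⟩ := hu
    rw [powElem_mul_gen_one]
    refine sub_mem ?_ (Submodule.smul_mem _ _ (powElem_mul_mem i (j + 1)))
    have := powElem_mul_mem (k := k) (i + 1) j
    rwa [show i + 1 + j = i + j + 1 by ring] at this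
  | zero => simp
  | add u v _ _ hu hv => rw [add_mul]; exact add_mem hu hv
  | smul r u _ hu => rw [smul_mul_assoc]; exact Submodule.smul_mem _ _ hu

theorem one_mem_homogeneous : (1 : JordanPlane k) ∈ homogeneous k 0 := by
  simpa [powElem] using powElem_mul_mem (k := k) 0 0

theorem gen_mem_homogeneous (i : Fin 2) : gen k i ∈ homogeneous k 1 := by
  fin_cases i
  · simpa using mul_gen_zero_mem (one_mem_homogeneous (k := k))
  · simpa using mul_gen_one_mem (one_mem_homogeneous (k := k))

/-- Each generator shifts by `-1`, so only the degree and the symbol of a homogeneous element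
matter. This yields the twisted product rule `symbol_mul`. -/
theorem shiftRep_of_mem {d : ℕ} {u : JordanPlane k} (hu : u ∈ homogeneous k d) (h : k[X]) :
    shiftRep k u h = symbol k u * taylor (-(d : k)) h := by
  induction hu using Submodule.span_induction with
  | mem u hu =>
    obtain ⟨i, j, rfl, rfl⟩ := hu
    rw [symbol_powElem_mul, shiftRep_powElem_mul]
  | zero => simp
  | add u v _ _ hu hv => simp [hu, hv, add_mul]
  | smul r u _ hu => simp [hu]

theorem symbol_mul {d : ℕ} {u : JordanPlane k} (hu : u ∈ homogeneous k d) (v : JordanPlane k) :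
    symbol k (u * v) = symbol k u * taylor (-(d : k)) (symbol k v) := by
  rw [symbol_mul_eq_shiftRep, shiftRep_of_mem hu]

theorem natDegree_symbol_le {d : ℕ} {u : JordanPlane k} (hu : u ∈ homogeneous k d) :
    (symbol k u).natDegree ≤ d := by
  induction hu using Submodule.span_induction with
  | mem u hu =>
    obtain ⟨i, j, rfl, rfl⟩ := hu
    rw [symbol_powElem_mul]
    exact (natDegree_X_pow_le i).trans (Nat.le_add_right i j)
  | zero => simp
  | add u v _ _ hu hv => rw [map_add]; exact natDegree_add_le_of_degree_le hu hv
  | smul r u _ hu => rw [map_smul]; exact (natDegree_smul_le _ _).trans hu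

variable (k) in
/-- The linear section of the symbol map with values of degree `d`. -/
noncomputable def ofSymbol (d : ℕ) : k[X] →ₗ[k] JordanPlane k :=
  (basisMonomials k).constr k fun i => powElem k i * gen k 0 ^ (d - i)

theorem ofSymbol_X_pow (d i : ℕ) :
    ofSymbol k d (X ^ i) = powElem k i * gen k 0 ^ (d - i) := by
  have := (basisMonomials k).constr_basis k (fun i => powElem k i * gen k 0 ^ (d - i)) i
  simp only [coe_basisMonomials, monomial_one_right_eq_X_pow] at this
  exact this

theorem ofSymbol_symbol {d : ℕ} {u : JordanPlane k} (hu : u ∈ homogeneous k d) :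
    ofSymbol k d (symbol k u) = u := by
  induction hu using Submodule.span_induction with
  | mem u hu =>
    obtain ⟨i, j, rfl, rfl⟩ := hu
    rw [symbol_powElem_mul, ofSymbol_X_pow, Nat.add_sub_cancel_left]
  | zero => simp
  | add u v _ _ hu hv => simp [hu, hv]
  | smul r u _ hu => simp [hu]

theorem symbol_ofSymbol (d : ℕ) (f : k[X]) : symbol k (ofSymbol k d f) = f := by
  induction f using Polynomial.induction_on' with
  | add p q hp hq => simp [hp, hq]
  | monomial n a =>
    rw [← mul_one a, ← smul_eq_mul, ← smul_monomial, monomial_one_right_eq_X_pow, map_smul,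
      map_smul, ofSymbol_X_pow, symbol_powElem_mul]

/-- The bound matters: for `i > d` the exponent `d - i` truncates to `0`, and the value on `X ^ i`
has degree `i` instead of `d`. -/
theorem ofSymbol_mem {d : ℕ} {f : k[X]} (hf : f.natDegree ≤ d) :
    ofSymbol k d f ∈ homogeneous k d := by
  rw [f.as_sum_range' (d + 1) (Nat.lt_succ_of_le hf), map_sum]
  refine Submodule.sum_mem _ fun i hi => ?_
  have hi : i ≤ d := Nat.lt_succ_iff.mp (Finset.mem_range.mp hi)
  rw [← mul_one (f.coeff i), ← smul_eq_mul, ← smul_monomial, monomial_one_right_eq_X_pow,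
    map_smul, ofSymbol_X_pow]
  refine Submodule.smul_mem _ _ ?_
  have := powElem_mul_mem (k := k) i (d - i)
  rwa [Nat.add_sub_cancel' hi] at this

theorem symbol_injOn {d : ℕ} {u v : JordanPlane k} (hu : u ∈ homogeneous k d)
    (hv : v ∈ homogeneous k d) (h : symbol k u = symbol k v) : u = v := by
  rw [← ofSymbol_symbol hu, h, ofSymbol_symbol hv]

variable (k) in
/-- The automorphism `x₁ ↦ x₁`, `x₂ ↦ x₂ + 2 x₁` of the Jordan plane. -/
noncomputable def shear : JordanPlane k →ₐ[k] JordanPlane k :=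
  lift (gen k 0) (gen k 1 + (2 : k) • gen k 0) (by
    simp only [add_mul, mul_add, gen_one_mul_gen_zero, smul_mul_assoc, mul_smul_comm]
    abel)

@[simp]
theorem shear_gen_zero : shear k (gen k 0) = gen k 0 := by simp [shear]

@[simp]
theorem shear_gen_one : shear k (gen k 1) = gen k 1 + (2 : k) • gen k 0 := by simp [shear]

/-- Translation by `2` commutes with the action of `x₁` and turns the multiplier `X - 1` of `x₂`
into `(X - 1) + 2`. -/
theorem shiftRep_shear (u : JordanPlane k) (h : k[X]) :
    shiftRep k (shear k u) (taylor 2 h) = taylor 2 (shiftRep k u h) := by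
  induction u using JordanPlane.induction generalizing h with
  | algebraMap r => simp [Algebra.algebraMap_eq_smul_one]
  | gen i =>
    fin_cases i
    · simp [taylor_taylor, add_comm]
    · simp [taylor_taylor, add_comm, smul_eq_C_mul]
      ring
  | add u v hu hv => simp [hu, hv]
  | mul u v hu hv => simp [hu, hv]

theorem symbol_shear (u : JordanPlane k) : symbol k (shear k u) = taylor 2 (symbol k u) := by
  rw [symbol_apply, symbol_apply, ← shiftRep_shear, taylor_one, C_1]

theorem shear_powElem_mem (i : ℕ) : shear k (powElem k i) ∈ homogeneous k i := by
  induction i with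
  | zero => simpa [powElem] using one_mem_homogeneous
  | succ i ih =>
    simp only [powElem, map_mul, map_add, shear_gen_one, map_smul, shear_gen_zero, mul_add,
      mul_smul_comm]
    exact add_mem (add_mem (mul_gen_one_mem ih) (Submodule.smul_mem _ _ (mul_gen_zero_mem ih)))
      (Submodule.smul_mem _ _ (mul_gen_zero_mem ih))

theorem mul_gen_zero_pow_mem {d : ℕ} {u : JordanPlane k} (hu : u ∈ homogeneous k d) (j : ℕ) :
    u * gen k 0 ^ j ∈ homogeneous k (d + j) := by
  induction j with
  | zero => simpa using hu
  | succ j ih => rw [pow_succ, ← mul_assoc]; exact mul_gen_zero_mem ih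

theorem shear_mem {d : ℕ} {u : JordanPlane k} (hu : u ∈ homogeneous k d) :
    shear k u ∈ homogeneous k d := by
  induction hu using Submodule.span_induction with
  | mem u hu =>
    obtain ⟨i, j, rfl, rfl⟩ := hu
    rw [map_mul, map_pow, shear_gen_zero]
    exact mul_gen_zero_pow_mem (shear_powElem_mem i) j
  | zero => simp
  | add u v _ _ hu hv => rw [map_add]; exact add_mem hu hv
  | smul r u _ hu => rw [map_smul]; exact Submodule.smul_mem _ _ hu

theorem shear_ofSymbol {d : ℕ} {f : k[X]} (hf : f.natDegree ≤ d) :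
    shear k (ofSymbol k d f) = ofSymbol k d (taylor 2 f) := by
  refine symbol_injOn (shear_mem (ofSymbol_mem hf)) (ofSymbol_mem ?_) ?_
  · rwa [natDegree_taylor]
  · rw [symbol_shear, symbol_ofSymbol, symbol_ofSymbol]

end Symbol

end JordanPlane

/-! ### Submodules of `k[X][Y]` stable under a simultaneous translation. -/

section DoubleShift

variable {k : Type*} [Field k]

/-- The substitution `X ↦ X + 2`, `Y ↦ Y + 2` on `k[X][Y]`. -/
noncomputable def doubleShift (Q : k[X][X]) : k[X][X] :=
  taylor (2 : k[X]) (Q.map (taylorAlgHom (2 : k) : k[X] →+* k[X]))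

/-- The polynomial takes one value at `0, 2, 4, …`, which are infinitely many points in
characteristic `0`. -/
theorem eq_C_of_taylor_two_eq_self [CharZero k] {q : k[X]} (h : taylor 2 q = q) :
    q = C (q.eval 0) := by
  have key : ∀ n : ℕ, q.eval (2 * n : k) = q.eval 0 := by
    intro n
    induction n with
    | zero => simp
    | succ n ih =>
      rw [← ih]
      conv_rhs => rw [← h, taylor_eval]
      congr 1
      push_cast; ring
  refine eq_of_infinite_eval_eq _ _ ((Set.infinite_range_of_injective
    (f := fun n : ℕ => (2 * n : k)) fun m n hmn => ?_).mono ?_)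
  · simpa using hmn
  · rintro _ ⟨n, rfl⟩
    simp [key n]

theorem taylorAlgHom_injective (r : k) :
    Function.Injective (taylorAlgHom r : k[X] →+* k[X]) :=
  taylor_injective r

theorem natDegree_doubleShift (Q : k[X][X]) : (doubleShift Q).natDegree = Q.natDegree := by
  rw [doubleShift, natDegree_taylor, natDegree_map_eq_of_injective (taylorAlgHom_injective 2)]

theorem coeff_natDegree_doubleShift (Q : k[X][X]) :
    (doubleShift Q).coeff Q.natDegree = taylor 2 Q.leadingCoeff := by
  rw [← natDegree_doubleShift, coeff_natDegree, doubleShift, leadingCoeff_taylor,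
    leadingCoeff_map_of_injective (taylorAlgHom_injective 2)]
  rfl

theorem coeff_taylor_of_monic {R : Type*} [CommRing R] {F : R[X]} (hF : F.Monic) {e : ℕ}
    (he : F.natDegree = e + 1) (r : R) :
    (taylor r F).coeff e = F.coeff e + (e + 1) * r := by
  have hd : (hasseDeriv e F).natDegree < 2 :=
    lt_of_le_of_lt (natDegree_hasseDeriv_le F e) (by omega)
  have h1 : F.coeff (1 + e) = 1 := by rw [add_comm, ← he]; exact hF
  rw [taylor_coeff, eval_eq_sum_range' hd, Finset.sum_range_succ, Finset.sum_range_one,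
    hasseDeriv_coeff, hasseDeriv_coeff, h1, add_comm 1 e, Nat.choose_succ_self_right]
  simp

theorem natDegree_le_sub {R : Type*} [Ring R] {p q : R[X]} {n : ℕ} (hp : p.natDegree ≤ n)
    (hq : q.natDegree ≤ n) : (p - q).natDegree ≤ n :=
  (natDegree_sub_le p q).trans (max_le hp hq)

/-- A `k[X]`-submodule of `k[X][Y]` stable under the double shift has a monic element of minimal
degree, whose subleading coefficient is linear with nonzero slope. -/
theorem exists_monic_generator [CharZero k] (N : Submodule k[X] k[X][X]) (m : ℕ)
    (hC : ∀ q : k[X], C q ∈ N → q = 0) (hm : ∃ Q ∈ N, Q ≠ 0 ∧ Q.natDegree ≤ m)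
    (hshift : ∀ Q ∈ N, Q.natDegree ≤ m → doubleShift Q ∈ N) :
    ∃ (e : ℕ) (P : k[X][X]), P ∈ N ∧ P.coeff (e + 1) = 1 ∧ P.natDegree = e + 1 ∧ e + 1 ≤ m ∧
      (∃ r : k, P.coeff e = C r - C ((e : k) + 1) * X) ∧
      ∀ Q ∈ N, Q.natDegree ≤ e + 1 → Q = C (Q.coeff (e + 1)) * P := by
  obtain ⟨Q₁, ⟨hQ₁N, hQ₁0⟩, hQ₁⟩ := (measure (fun Q : k[X][X] => Q.natDegree)).wf.has_min
    {Q | Q ∈ N ∧ Q ≠ 0} (by obtain ⟨Q, h1, h2, -⟩ := hm; exact ⟨Q, h1, h2⟩)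
  set n := Q₁.natDegree with hn
  have hnm : n ≤ m := by
    obtain ⟨Q, h1, h2, h3⟩ := hm
    exact (not_lt.mp (hQ₁ Q ⟨h1, h2⟩)).trans h3
  have hA : ∀ R ∈ N, R.natDegree ≤ n → R.coeff n = 0 → R = 0 := by
    intro R hR hRn hRc
    by_contra h0
    have h1 : n ≤ R.natDegree := not_lt.mp (hQ₁ R ⟨hR, h0⟩)
    have h2 : R.natDegree = n := le_antisymm hRn h1
    rw [← h2, coeff_natDegree, leadingCoeff_eq_zero] at hRc
    exact h0 hRc
  -- Among elements of least `Y`-degree, `Q` has a leading coefficient of least degree in `X`.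
  obtain ⟨Q, ⟨hQN, hQn, hQ0⟩, hQ⟩ :=
    (measure (fun Q : k[X][X] => (Q.coeff n).natDegree)).wf.has_min
      {Q | Q ∈ N ∧ Q.natDegree ≤ n ∧ Q.coeff n ≠ 0}
      ⟨Q₁, hQ₁N, le_rfl, by rw [hn, coeff_natDegree, Ne, leadingCoeff_eq_zero]; exact hQ₁0⟩
  have hdeg : Q.natDegree = n := le_antisymm hQn (le_natDegree_of_ne_zero hQ0)
  have hinv : taylor 2 (Q.coeff n) = Q.coeff n := by
    by_contra hne
    have hsc : (doubleShift Q).coeff n = taylor 2 (Q.coeff n) := by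
      rw [← hdeg, coeff_natDegree_doubleShift, coeff_natDegree]
    have hlt : (taylor 2 (Q.coeff n) - Q.coeff n).degree < (Q.coeff n).degree := by
      rw [← degree_taylor (Q.coeff n) 2]
      refine degree_sub_lt_left (degree_taylor _ _) ?_ (leadingCoeff_taylor _ _)
      rwa [Ne, taylor_eq_zero]
    -- Translation preserves the top `X`-term of the leading coefficient, so the difference would
    -- contradict the choice of `Q`.
    refine hQ (doubleShift Q - Q) ⟨sub_mem (hshift Q hQN (hQn.trans hnm)) hQN,
      natDegree_le_sub (by rw [natDegree_doubleShift]; exact hQn) hQn, ?_⟩ ?_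
    · rwa [coeff_sub, hsc, sub_ne_zero]
    · show ((doubleShift Q - Q).coeff n).natDegree < _
      rw [coeff_sub, hsc]
      exact natDegree_lt_natDegree (sub_ne_zero.mpr hne) hlt
  obtain ⟨r, hr⟩ : ∃ r, Q.coeff n = C r := ⟨_, eq_C_of_taylor_two_eq_self hinv⟩
  have hr0 : r ≠ 0 := by rintro rfl; exact hQ0 (by simpa using hr)
  set P : k[X][X] := C (C r⁻¹) * Q with hP
  have hPN : P ∈ N := by rw [hP, ← smul_eq_C_mul]; exact N.smul_mem _ hQN
  have hPc : P.coeff n = 1 := by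
    rw [hP, coeff_C_mul, hr, ← C_mul, inv_mul_cancel₀ hr0, C_1]
  have hPdeg : P.natDegree = n := le_antisymm ((natDegree_C_mul_le _ _).trans hQn)
    (le_natDegree_of_ne_zero (by rw [hPc]; exact one_ne_zero))
  have huniq : ∀ R ∈ N, R.natDegree ≤ n → R = C (R.coeff n) * P := by
    intro R hR hRn
    refine sub_eq_zero.mp (hA _ (sub_mem hR ?_) (natDegree_le_sub hRn ?_) ?_)
    · rw [← smul_eq_C_mul]; exact N.smul_mem _ hPN
    · exact (natDegree_C_mul_le _ _).trans hPdeg.le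
    · rw [coeff_sub, coeff_C_mul, hPc, mul_one, sub_self]
  have hPshift : doubleShift P = P := by
    have h := huniq _ (hshift P hPN (hPdeg.le.trans hnm))
      ((natDegree_doubleShift P).trans hPdeg).le
    have h1 : (doubleShift P).coeff n = 1 := by
      rw [← hPdeg, coeff_natDegree_doubleShift, ← coeff_natDegree, hPdeg, hPc, taylor_one, C_1]
    rwa [h1, C_1, one_mul] at h
  obtain ⟨e, he⟩ : ∃ e, n = e + 1 := by
    refine Nat.exists_eq_succ_of_ne_zero fun h0 => ?_
    rw [h0] at hPdeg hPc
    have := hC (P.coeff 0) (by rwa [← eq_C_of_natDegree_eq_zero hPdeg])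
    rw [hPc] at this
    exact one_ne_zero this
  rw [he] at hPc hPdeg huniq hnm
  refine ⟨e, P, hPN, hPc, hPdeg, hnm, ?_, huniq⟩
  have hPmonic : P.Monic := by rw [Monic, ← coeff_natDegree, hPdeg, hPc]
  have h := coeff_taylor_of_monic (hPmonic.map (taylorAlgHom (2 : k) : k[X] →+* k[X]))
    (by rw [natDegree_map_eq_of_injective (taylorAlgHom_injective 2), hPdeg]) (2 : k[X])
  change (doubleShift P).coeff e = _ at h
  rw [hPshift, coeff_map] at h
  -- Invariance of `P` gives `q(X + 2) + 2(e + 1) = q(X)` for its subleading coefficient `q`, so `q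
  -- + (e + 1)X` is 2-periodic.
  have h2 : taylor 2 (P.coeff e + C ((e : k) + 1) * X) = P.coeff e + C ((e : k) + 1) * X := by
    rw [map_add, taylor_mul, taylor_C, taylor_X]
    conv_rhs => rw [h]
    simp [mul_add]
    rw [show C (2 : k) = 2 from rfl]
    ring
  refine ⟨_, eq_sub_of_add_eq (eq_C_of_taylor_two_eq_self h2)⟩

end DoubleShift

/-! ### Removing a coproduct with the antipode. -/

section Untwisting

variable {k : Type*} [Field k] {K : Type*} [Ring K] [HopfAlgebra k K]

variable (k K) in
/-- The map `g ⊗ h ↦ g S(h₁) ⊗ h₂`. -/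
noncomputable def untwist : K ⊗[k] K →ₗ[k] K ⊗[k] K :=
  (LinearMap.mul' k K).rTensor K ∘ₗ (TensorProduct.assoc k K K K).symm.toLinearMap ∘ₗ
    ((HopfAlgebra.antipode k (A := K)).rTensor K ∘ₗ Coalgebra.comul).lTensor K

theorem untwist_mul (g : K) (w : K ⊗[k] K) :
    untwist k K ((g ⊗ₜ 1) * w) = (g ⊗ₜ 1) * untwist k K w := by
  induction w with
  | zero => simp
  | add v w hv hw => rw [mul_add, map_add, map_add, mul_add, hv, hw]
  | tmul h l =>
    simp only [untwist, Algebra.TensorProduct.tmul_mul_tmul, one_mul, LinearMap.comp_apply,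
      LinearMap.lTensor_tmul]
    generalize Coalgebra.comul (R := k) l = z
    induction z with
    | zero => simp
    | add v w hv hw => simp only [map_add, TensorProduct.tmul_add, mul_add, hv, hw]
    | tmul a b => simp [mul_assoc]

/-- In Sweedler notation, `h₁ S(h₂) ⊗ h₃ = 1 ⊗ h` by coassociativity and the antipode axiom. -/
theorem untwist_comul (h : K) : untwist k K (Coalgebra.comul h) = 1 ⊗ₜ h := by
  have key : ∀ w : K ⊗[k] K, (LinearMap.mul' k K).rTensor K
      ((TensorProduct.assoc k K K K).symm (((HopfAlgebra.antipode k (A := K)).rTensor K).lTensor K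
        (TensorProduct.assoc k K K K ((Coalgebra.comul (R := k)).rTensor K w)))) =
      (Algebra.linearMap k K).rTensor K ((Coalgebra.counit (R := k)).rTensor K w) := by
    intro w
    induction w with
    | zero => simp
    | add v w hv hw => simp only [map_add, hv, hw]
    | tmul g l =>
      simp only [LinearMap.rTensor_tmul, Algebra.linearMap_apply,
        ← HopfAlgebra.mul_antipode_lTensor_comul_apply]
      generalize Coalgebra.comul (R := k) g = z
      induction z with
      | zero => simp
      | add v w hv hw => simp only [map_add, TensorProduct.add_tmul, hv, hw]
      | tmul a b => simp
  rw [untwist, LinearMap.lTensor_comp, LinearMap.comp_apply, LinearMap.comp_apply,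
    LinearMap.comp_apply, ← Coalgebra.coassoc_apply, LinearEquiv.coe_coe, key,
    Coalgebra.rTensor_counit_comul]
  simp

end Untwisting

/-! ### The dual of `K` acting on relations. -/

section Contract

variable {k : Type*} [Field k] {A K : Type*}

section Module

variable [AddCommGroup A] [Module k A] [AddCommGroup K] [Module k K]

/-- Evaluation of the second tensor factor at a functional. -/
noncomputable def sliceRight (f : K →ₗ[k] k) : A ⊗[k] K →ₗ[k] A :=
  (TensorProduct.rid k A).toLinearMap ∘ₗ f.lTensor A

@[simp]
theorem sliceRight_tmul (f : K →ₗ[k] k) (u : A) (h : K) : sliceRight f (u ⊗ₜ[k] h) = f h • u := by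
  simp [sliceRight]

theorem eq_tmul_of_sliceRight {t : A ⊗[k] K} {u : A} {g : K}
    (h : ∀ f : K →ₗ[k] k, sliceRight f t = f g • u) : t = u ⊗ₜ g := by
  classical
  let b := Module.Basis.ofVectorSpace k K
  refine (TensorProduct.equivFinsuppOfBasisRight (M := A) b).injective ?_
  ext i
  have key : ∀ t : A ⊗[k] K, TensorProduct.equivFinsuppOfBasisRight b t i =
      sliceRight (b.coord i) t := by
    intro t
    induction t with
    | zero => simp
    | add v w hv hw => simp only [map_add, Finsupp.add_apply, hv, hw]
    | tmul v w => simp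
  rw [key, key, h, sliceRight_tmul]

end Module

variable [Ring A] [Algebra k A] [Ring K] [HopfAlgebra k K]

/-- The left relations among the elements `ρ (u i)` are stable under the action of the dual. -/
theorem sum_sliceRight_mul_eq_zero {ρ : A →ₐ[k] A ⊗[k] K} (hρ : IsRightComoduleAlgebra ρ)
    {ι : Type*} (s : Finset ι) (p u : ι → A)
    (h : ∑ i ∈ s, (p i ⊗ₜ[k] (1 : K)) * ρ (u i) = 0) (f : K →ₗ[k] k) :
    ∑ i ∈ s, (sliceRight f (ρ (p i)) ⊗ₜ[k] (1 : K)) * ρ (u i) = 0 := by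
  let lam : K ⊗[k] K →ₗ[k] K :=
    (TensorProduct.lid k K).toLinearMap ∘ₗ f.rTensor K ∘ₗ untwist k K
  have hlam : ∀ g h : K, lam ((g ⊗ₜ 1) * Coalgebra.comul h) = f g • h := by
    intro g h
    simp [lam, untwist_mul, untwist_comul]
  -- Applying `ρ ⊗ id` to the relation gives a sum of `p₀ u₀ ⊗ p₁ u₁ ⊗ u₂`; `Θ` sends such a term to
  -- `f(p₁) p₀ u₀ ⊗ u₁`.
  let Θ : (A ⊗[k] K) ⊗[k] K →ₗ[k] A ⊗[k] K :=
    lam.lTensor A ∘ₗ (TensorProduct.assoc k A K K).toLinearMap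
  have hΘ : ∀ r t : A ⊗[k] K, Θ ((r ⊗ₜ[k] (1 : K)) *
      (TensorProduct.assoc k A K K).symm ((Coalgebra.comul (R := k) (A := K)).lTensor A t)) =
      (sliceRight f r ⊗ₜ[k] (1 : K)) * t := by
    intro r t
    induction r with
    | zero => simp
    | add v w hv hw => simp only [map_add, TensorProduct.add_tmul, add_mul, hv, hw]
    | tmul w g =>
      induction t with
      | zero => simp
      | add v w hv hw => simp only [map_add, mul_add, hv, hw]
      | tmul v h =>
        have : Θ (((w ⊗ₜ[k] g) ⊗ₜ[k] (1 : K)) * (TensorProduct.assoc k A K K).symm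
            (v ⊗ₜ[k] Coalgebra.comul (R := k) h)) =
            (w * v) ⊗ₜ lam ((g ⊗ₜ 1) * Coalgebra.comul h) := by
          generalize Coalgebra.comul (R := k) h = z
          induction z with
          | zero => simp
          | add v w hv hw => simp only [map_add, TensorProduct.tmul_add, mul_add, hv, hw]
          | tmul a b => simp [Θ]
        rw [LinearMap.lTensor_tmul, this, hlam]
        simp [TensorProduct.smul_tmul']
  have h2 := congrArg (fun t => Θ (ρ.toLinearMap.rTensor K t)) h
  simp only [map_sum, map_zero] at h2
  rw [← h2]
  refine Finset.sum_congr rfl fun i _ => ?_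
  rw [← hΘ, ← AlgHom.toLinearMap_apply ρ (u i), ← hρ.coassoc, LinearEquiv.symm_apply_apply]
  congr 1
  generalize ρ.toLinearMap (u i) = t
  induction t with
  | zero => simp
  | add v w hv hw => simp only [map_add, mul_add, hv, hw]
  | tmul v h => simp

end Contract

/-! ### The quantum determinant and the square of the antipode. -/

section QuantumDeterminant

variable {k : Type*} [Field k] {K : Type*} [Ring K] [HopfAlgebra k K]

/-- The data of a `2 × 2` comatrix `!![a, b; c, d]` compatible with the Jordan plane relation. -/
structure IsJordanComatrix (k : Type*) {K : Type*} [Field k] [Ring K] [HopfAlgebra k K]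
    (a b c d : K) : Prop where
  comul_a : Coalgebra.comul (R := k) a = a ⊗ₜ a + b ⊗ₜ c
  comul_b : Coalgebra.comul (R := k) b = a ⊗ₜ b + b ⊗ₜ d
  comul_c : Coalgebra.comul (R := k) c = c ⊗ₜ a + d ⊗ₜ c
  comul_d : Coalgebra.comul (R := k) d = c ⊗ₜ b + d ⊗ₜ d
  counit_a : Coalgebra.counit (R := k) a = 1
  counit_b : Coalgebra.counit (R := k) b = 0
  counit_c : Coalgebra.counit (R := k) c = 0
  counit_d : Coalgebra.counit (R := k) d = 1
  rel₁ : b * a + d * a = a * b + c * b + a * a + c * a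
  rel₂ : b * c + d * a = a * d + c * b + a * c + c * a
  rel₃ : d * c = c * d + c * c

namespace IsJordanComatrix

variable {a b c d : K} (h : IsJordanComatrix k a b c d)

include h

/-- The defining relation spans a one-dimensional subcomodule of `V ⊗ V`, where `V` is the span of
the generators. This element is its weight, read off as the coefficient of `x₂ ⊗ x₁`. -/
theorem isGroupLikeElem_det : IsGroupLikeElem k (d * a - c * a - c * b) where
  counit_eq_one := by
    simp [h.counit_a, h.counit_b, h.counit_c, h.counit_d]
  comul_eq_tmul_self := by
    have e1 : b * a - a * a - a * b = -(d * a - c * a - c * b) := by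
      linear_combination (norm := noncomm_ring) h.rel₁
    have e2 : b * c - a * c - a * d = -(d * a - c * a - c * b) := by
      linear_combination (norm := noncomm_ring) h.rel₂
    have e3 : d * c - c * c - c * d = 0 := by
      linear_combination (norm := noncomm_ring) h.rel₃
    have : Coalgebra.comul (R := k) (d * a - c * a - c * b) =
        (c * a) ⊗ₜ (b * a - a * a - a * b) + (c * b) ⊗ₜ (b * c - a * c - a * d)
          + (d * a) ⊗ₜ (d * a - c * a - c * b) + (d * b) ⊗ₜ (d * c - c * c - c * d) := by
      simp only [map_sub, Bialgebra.comul_mul, h.comul_a, h.comul_b, h.comul_c, h.comul_d,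
        add_mul, mul_add, Algebra.TensorProduct.tmul_mul_tmul, TensorProduct.tmul_sub]
      abel
    rw [this, e1, e2, e3]
    simp only [TensorProduct.tmul_neg, TensorProduct.sub_tmul, TensorProduct.tmul_zero]
    abel

/-- The square of the antipode, corrected by conjugation by the quantum determinant, acts on the
comatrix as conjugation by a unipotent scalar matrix. -/
theorem exists_algHom : ∃ φ : K →ₐ[k] K, φ a = a - 2 * c ∧ φ c = c ∧ φ d = d + 2 * c ∧
    φ b = b + 2 * a - 2 * d - 4 * c := by
  set D := d * a - c * a - c * b with hD
  have hg := h.isGroupLikeElem_det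
  rw [← hD] at hg
  set D' := HopfAlgebra.antipode k D with hD'
  have hDD' : D * D' = 1 := hg.mul_antipode_cancel
  have hD'D : D' * D = 1 := hg.antipode_mul_cancel
  have hSD' : HopfAlgebra.antipode k D' = D := hg.antipode_antipode
  set S := HopfAlgebra.antipode k (A := K) with hS
  have hmul : ∀ v w, S (v * w) = S w * S v := HopfAlgebra.antipode_mul_antidistrib
  have hN : !![S a, S b; S c, S d] * !![a, b; c, d] = (1 : Matrix (Fin 2) (Fin 2) K) := by
    have ea := HopfAlgebra.mul_antipode_rTensor_comul_apply (R := k) a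
    have eb := HopfAlgebra.mul_antipode_rTensor_comul_apply (R := k) b
    have ec := HopfAlgebra.mul_antipode_rTensor_comul_apply (R := k) c
    have ed := HopfAlgebra.mul_antipode_rTensor_comul_apply (R := k) d
    rw [h.comul_a, h.counit_a] at ea
    rw [h.comul_b, h.counit_b] at eb
    rw [h.comul_c, h.counit_c] at ec
    rw [h.comul_d, h.counit_d] at ed
    simp only [map_add, LinearMap.rTensor_tmul, LinearMap.mul'_apply, map_one, map_zero]
      at ea eb ec ed
    rw [Matrix.mul_fin_two, Matrix.one_fin_two, ea, eb, ec, ed]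
  -- A quantum adjugate divided by `D`. Being a right inverse, it agrees with the left inverse given
  -- by the antipode.
  have hR : !![a, b; c, d] * !![(c + d) * D', (c + d - a - b) * D'; -c * D', (a - c) * D'] =
      (1 : Matrix (Fin 2) (Fin 2) K) := by
    have e1 : a * (c + d) + b * (-c) = D := by
      rw [hD]; linear_combination (norm := noncomm_ring) -h.rel₂
    have e2 : a * (c + d - a - b) + b * (a - c) = 0 := by
      linear_combination (norm := noncomm_ring) h.rel₁ - h.rel₂
    have e3 : c * (c + d) + d * (-c) = 0 := by
      linear_combination (norm := noncomm_ring) -h.rel₃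
    have e4 : c * (c + d - a - b) + d * (a - c) = D := by
      rw [hD]; linear_combination (norm := noncomm_ring) -h.rel₃
    rw [Matrix.mul_fin_two, Matrix.one_fin_two]
    simp only [← mul_assoc, ← add_mul, e1, e2, e3, e4, hDD', zero_mul]
  have hNR := left_inv_eq_right_inv hN hR
  have hSa : S a = (c + d) * D' := congrFun (congrFun hNR 0) 0
  have hSb : S b = (c + d - a - b) * D' := congrFun (congrFun hNR 0) 1
  have hSc : S c = -c * D' := congrFun (congrFun hNR 1) 0
  have hSd : S d = (a - c) * D' := congrFun (congrFun hNR 1) 1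
  -- If `S v = w D'` then `S (S v) = D (S w)`; conjugating by `D` removes the left factor, and the
  -- right `D` cancels the `D'` in `S w`.
  let φ : K →ₐ[k] K := AlgHom.ofLinearMap
    (LinearMap.mulLeft k D' ∘ₗ LinearMap.mulRight k D ∘ₗ S ∘ₗ S)
    (by simp [hS, hD'D])
    (by
      intro v w
      simp only [LinearMap.comp_apply, LinearMap.mulLeft_apply, LinearMap.mulRight_apply, hmul]
      simp only [mul_assoc]
      rw [← mul_assoc D D', hDD', one_mul])
  have hφ : ∀ v w : K, S v = w * D' → φ v = S w * D := by
    intro v w hv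
    simp only [φ, AlgHom.ofLinearMap_apply, LinearMap.comp_apply, LinearMap.mulLeft_apply,
      LinearMap.mulRight_apply, hv, hmul, hSD']
    rw [← mul_assoc, ← mul_assoc, hD'D, one_mul]
  have hcancel : ∀ w : K, w * D' * D = w := fun w => by rw [mul_assoc, hD'D, mul_one]
  refine ⟨φ, ?_, ?_, ?_, ?_⟩
  · rw [hφ a _ hSa, map_add, hSc, hSd, ← add_mul, hcancel]
    noncomm_ring
  · rw [hφ c _ hSc, map_neg, hSc, ← neg_mul, hcancel, neg_neg]
  · rw [hφ d _ hSd, map_sub, hSa, hSc, ← sub_mul, hcancel]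
    noncomm_ring
  · rw [hφ b _ hSb, map_sub, map_sub, map_add, hSa, hSb, hSc, hSd, ← add_mul, ← sub_mul,
      ← sub_mul, hcancel]
    noncomm_ring

end IsJordanComatrix

end QuantumDeterminant

/-! ### The comatrix of a homogeneous coaction. -/

section Comatrix

variable {k : Type*} [Field k] {K : Type*} [Ring K] [HopfAlgebra k K]

open JordanPlane

/-- Evaluation of the first tensor factor at a functional. -/
noncomputable def sliceLeft {A W : Type*} [AddCommGroup A] [Module k A] [AddCommGroup W]
    [Module k W] (f : A →ₗ[k] k) : A ⊗[k] W →ₗ[k] W :=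
  (TensorProduct.lid k W).toLinearMap ∘ₗ f.rTensor W

@[simp]
theorem sliceLeft_tmul {A W : Type*} [AddCommGroup A] [Module k A] [AddCommGroup W]
    [Module k W] (f : A →ₗ[k] k) (u : A) (h : W) : sliceLeft f (u ⊗ₜ[k] h) = f u • h := by
  simp [sliceLeft]

theorem symbol_gen_zero : symbol k (gen k 0) = 1 := by simp [symbol_apply]

theorem symbol_gen_one : symbol k (gen k 1) = X - 1 := by simp [symbol_apply]

theorem isJordanComatrix_of_coaction {ρ : JordanPlane k →ₐ[k] JordanPlane k ⊗[k] K}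
    (hρ : IsRightComoduleAlgebra ρ) {a b c d : K}
    (h0 : ρ (gen k 0) = gen k 0 ⊗ₜ[k] a + gen k 1 ⊗ₜ[k] c)
    (h1 : ρ (gen k 1) = gen k 0 ⊗ₜ[k] b + gen k 1 ⊗ₜ[k] d) :
    IsJordanComatrix k a b c d := by
  let e : k → JordanPlane k →ₗ[k] k := fun r => leval r ∘ₗ symbol k
  let t : ℕ → JordanPlane k →ₗ[k] k := fun n => lcoeff k n ∘ₗ symbol k
  have e0 : e 1 (gen k 0) = 1 := by simp [e, symbol_gen_zero]
  have e1 : e 1 (gen k 1) = 0 := by simp [e, symbol_gen_one]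
  have t0 : t 1 (gen k 0) = 0 := by simp [t, symbol_gen_zero, coeff_one]
  have t1 : t 1 (gen k 1) = 1 := by simp [t, symbol_gen_one, coeff_one]
  have c0 := hρ.coassoc (gen k 0)
  have c1 := hρ.coassoc (gen k 1)
  have n0 := hρ.counit (gen k 0)
  have n1 := hρ.counit (gen k 1)
  simp only [AlgHom.toLinearMap_apply, h0, h1, map_add, LinearMap.rTensor_tmul,
    LinearMap.lTensor_tmul, TensorProduct.add_tmul, TensorProduct.assoc_tmul,
    TensorProduct.rid_tmul] at c0 c1 n0 n1
  have r := congrArg ρ (gen_one_mul_gen_zero (k := k))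
  simp only [map_mul, map_add, pow_two, h0, h1, add_mul, mul_add,
    Algebra.TensorProduct.tmul_mul_tmul] at r
  have s00 : symbol k (gen k 0 * gen k 0) = 1 := by
    simp [symbol_mul (gen_mem_homogeneous 0), symbol_gen_zero]
  have s01 : symbol k (gen k 0 * gen k 1) = X - 2 := by
    rw [symbol_mul (gen_mem_homogeneous 0), symbol_gen_zero, symbol_gen_one]
    simp
    ring
  have s10 : symbol k (gen k 1 * gen k 0) = X - 1 := by
    simp [symbol_mul (gen_mem_homogeneous 1), symbol_gen_zero, symbol_gen_one]
  have s11 : symbol k (gen k 1 * gen k 1) = (X - 1) * (X - 2) := by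
    rw [symbol_mul (gen_mem_homogeneous 1), symbol_gen_one]
    congr 1
    simp
    ring
  -- The degree-two symbols are `1`, `X - 2`, `X - 1` and `(X - 1)(X - 2)`. Evaluation at `2` or `1`
  -- and the coefficient of `X ^ 2` therefore separate the three relations.
  have r1 := congrArg (sliceLeft (e 2)) r
  have r2 := congrArg (sliceLeft (e 1)) r
  have r3 := congrArg (sliceLeft (t 2)) r
  have q : ((X - 1) * (X - 2) : k[X]).coeff 2 = 1 := by
    rw [show ((X - 1) * (X - 2) : k[X]) = X ^ 2 - C 3 * X + C 2 by
      rw [show (C 3 : k[X]) = 3 from rfl, show (C 2 : k[X]) = 2 from rfl]; ring]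
    simp
  simp [e, t, s00, s01, s10, s11, q, coeff_one, coeff_X] at r1 r2 r3
  rw [show (2 : k) - 1 = 1 by norm_num] at r1
  rw [show (1 : k) - 2 = -1 by norm_num] at r2
  simp only [one_smul, neg_smul] at r1 r2
  have c0e := congrArg (sliceLeft (e 1)) c0
  have c1e := congrArg (sliceLeft (e 1)) c1
  have c0t := congrArg (sliceLeft (t 1)) c0
  have c1t := congrArg (sliceLeft (t 1)) c1
  simp [e0, e1, t0, t1] at c0e c1e c0t c1t
  have n0e := congrArg (e 1) n0
  have n1e := congrArg (e 1) n1
  have n0t := congrArg (t 1) n0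
  have n1t := congrArg (t 1) n1
  simp [e0, e1, t0, t1] at n0e n1e n0t n1t
  refine ⟨c0e.symm, c1e.symm, c0t.symm, c1t.symm, n0e, n1e, n0t, n1t, ?_, ?_, ?_⟩
  · linear_combination (norm := noncomm_ring) r1
  · linear_combination (norm := noncomm_ring) r1 - r2
  · linear_combination (norm := noncomm_ring) r3

end Comatrix

namespace JordanPlane

/-! ### Homogeneous elements and symbols with coefficients in `K`. -/

section HomogeneousTensor

variable {k : Type*} [Field k] {K : Type*} [Ring K] [Algebra k K]

variable (k K) in
/-- The subspace `A_d ⊗ K` of `A ⊗ K`, for `A` the Jordan plane. -/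
def homogeneousTensor (d : ℕ) : Submodule k (JordanPlane k ⊗[k] K) :=
  Submodule.span k {t | ∃ u ∈ homogeneous k d, ∃ h : K, t = u ⊗ₜ h}

theorem tmul_mem_homogeneousTensor {d : ℕ} {u : JordanPlane k} (hu : u ∈ homogeneous k d)
    (h : K) : u ⊗ₜ[k] h ∈ homogeneousTensor k K d :=
  Submodule.subset_span ⟨u, hu, h, rfl⟩

theorem mul_gen_mem {d : ℕ} {u : JordanPlane k} (hu : u ∈ homogeneous k d) (i : Fin 2) :
    u * gen k i ∈ homogeneous k (d + 1) := by
  fin_cases i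
  · exact mul_gen_zero_mem hu
  · exact mul_gen_one_mem hu

theorem mul_gen_tmul_mem {d : ℕ} {t : JordanPlane k ⊗[k] K} (ht : t ∈ homogeneousTensor k K d)
    (i : Fin 2) (g : K) : t * (gen k i ⊗ₜ[k] g) ∈ homogeneousTensor k K (d + 1) := by
  induction ht using Submodule.span_induction with
  | mem t ht =>
    obtain ⟨u, hu, h, rfl⟩ := ht
    rw [Algebra.TensorProduct.tmul_mul_tmul]
    exact tmul_mem_homogeneousTensor (mul_gen_mem hu i) _
  | zero => simp
  | add v w _ _ hv hw => rw [add_mul]; exact add_mem hv hw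
  | smul r v _ hv => rw [smul_mul_assoc]; exact Submodule.smul_mem _ _ hv

theorem tmul_one_mul_mem {d e : ℕ} {u : JordanPlane k} (hu : u ∈ homogeneous k d)
    {t : JordanPlane k ⊗[k] K} (ht : t ∈ homogeneousTensor k K e) :
    (u ⊗ₜ[k] (1 : K)) * t ∈ homogeneousTensor k K (d + e) := by
  induction ht using Submodule.span_induction with
  | mem t ht =>
    obtain ⟨v, hv, h, rfl⟩ := ht
    rw [Algebra.TensorProduct.tmul_mul_tmul, one_mul]
    refine tmul_mem_homogeneousTensor ?_ _
    clear h
    induction hv using Submodule.span_induction with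
    | mem v hv =>
      obtain ⟨i, j, rfl, rfl⟩ := hv
      rw [← mul_assoc, ← add_assoc]
      refine mul_gen_zero_pow_mem ?_ j
      induction i with
      | zero => simpa [powElem] using hu
      | succ i ih =>
        rw [powElem, ← mul_assoc, mul_add, mul_smul_comm, ← add_assoc]
        exact add_mem (mul_gen_one_mem ih) (Submodule.smul_mem _ _ (mul_gen_zero_mem ih))
    | zero => simp
    | add v w _ _ hv hw => rw [mul_add]; exact add_mem hv hw
    | smul r v _ hv => rw [mul_smul_comm]; exact Submodule.smul_mem _ _ hv
  | zero => simp
  | add v w _ _ hv hw => rw [mul_add]; exact add_mem hv hw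
  | smul r v _ hv => rw [mul_smul_comm]; exact Submodule.smul_mem _ _ hv

theorem sliceRight_mem {d : ℕ} {t : JordanPlane k ⊗[k] K} (ht : t ∈ homogeneousTensor k K d)
    (f : K →ₗ[k] k) : sliceRight f t ∈ homogeneous k d := by
  induction ht using Submodule.span_induction with
  | mem t ht =>
    obtain ⟨u, hu, h, rfl⟩ := ht
    rw [sliceRight_tmul]
    exact Submodule.smul_mem _ _ hu
  | zero => simp
  | add v w _ _ hv hw => rw [map_add]; exact add_mem hv hw
  | smul r v _ hv => rw [map_smul]; exact Submodule.smul_mem _ _ hv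

theorem map_mem_homogeneousTensor {ρ : JordanPlane k →ₐ[k] JordanPlane k ⊗[k] K}
    {a b c d : K} (h0 : ρ (gen k 0) = gen k 0 ⊗ₜ[k] a + gen k 1 ⊗ₜ[k] c)
    (h1 : ρ (gen k 1) = gen k 0 ⊗ₜ[k] b + gen k 1 ⊗ₜ[k] d)
    {n : ℕ} {u : JordanPlane k} (hu : u ∈ homogeneous k n) :
    ρ u ∈ homogeneousTensor k K n := by
  have hm0 : ∀ {n : ℕ} {t : JordanPlane k ⊗[k] K}, t ∈ homogeneousTensor k K n →
      t * ρ (gen k 0) ∈ homogeneousTensor k K (n + 1) := fun ht => by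
    rw [h0, mul_add]
    exact add_mem (mul_gen_tmul_mem ht 0 a) (mul_gen_tmul_mem ht 1 c)
  have hm1 : ∀ {n : ℕ} {t : JordanPlane k ⊗[k] K}, t ∈ homogeneousTensor k K n →
      t * ρ (gen k 1) ∈ homogeneousTensor k K (n + 1) := fun ht => by
    rw [h1, mul_add]
    exact add_mem (mul_gen_tmul_mem ht 0 b) (mul_gen_tmul_mem ht 1 d)
  induction hu using Submodule.span_induction with
  | mem u hu =>
    obtain ⟨i, j, rfl, rfl⟩ := hu
    induction j with
    | zero =>
      rw [pow_zero, mul_one, add_zero]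
      induction i with
      | zero =>
        rw [powElem, map_one]
        exact tmul_mem_homogeneousTensor one_mem_homogeneous 1
      | succ i ih =>
        rw [powElem, map_mul, map_add, map_smul, mul_add, mul_smul_comm]
        exact add_mem (hm1 ih) (Submodule.smul_mem _ _ (hm0 ih))
    | succ j ih =>
      rw [pow_succ, ← mul_assoc, map_mul, ← add_assoc]
      exact hm0 ih
  | zero => simp
  | add v w _ _ hv hw => rw [map_add]; exact add_mem hv hw
  | smul r v _ hv => rw [map_smul]; exact Submodule.smul_mem _ _ hv

variable (k K) in
/-- The symbol map with coefficients in `K`. -/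
noncomputable def symbolTensor : JordanPlane k ⊗[k] K →ₗ[k] k[X] ⊗[k] K :=
  (symbol k).rTensor K

@[simp]
theorem symbolTensor_tmul (u : JordanPlane k) (h : K) :
    symbolTensor k K (u ⊗ₜ h) = symbol k u ⊗ₜ h := rfl

theorem eq_zero_of_symbolTensor_eq_zero {d : ℕ} {t : JordanPlane k ⊗[k] K}
    (ht : t ∈ homogeneousTensor k K d) (h : symbolTensor k K t = 0) : t = 0 := by
  have key : (ofSymbol k d).rTensor K (symbolTensor k K t) = t := by
    clear h
    induction ht using Submodule.span_induction with
    | mem t ht =>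
      obtain ⟨u, hu, h, rfl⟩ := ht
      rw [symbolTensor_tmul, LinearMap.rTensor_tmul, ofSymbol_symbol hu]
    | zero => simp
    | add v w _ _ hv hw => rw [map_add, map_add, hv, hw]
    | smul r v _ hv => rw [map_smul, map_smul, hv]
  rw [← key, h, map_zero]

theorem symbolTensor_tmul_one_mul {d : ℕ} {u : JordanPlane k} (hu : u ∈ homogeneous k d)
    (t : JordanPlane k ⊗[k] K) :
    symbolTensor k K ((u ⊗ₜ[k] (1 : K)) * t) =
      symbol k u • (taylor (-(d : k))).rTensor K (symbolTensor k K t) := by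
  induction t with
  | zero => simp
  | add v w hv hw => simp only [mul_add, map_add, hv, hw, smul_add]
  | tmul v h =>
    rw [Algebra.TensorProduct.tmul_mul_tmul, one_mul, symbolTensor_tmul, symbol_mul hu,
      symbolTensor_tmul, LinearMap.rTensor_tmul, TensorProduct.smul_tmul', smul_eq_mul]

theorem sliceRight_smul (f : K →ₗ[k] k) (q : k[X]) (t : k[X] ⊗[k] K) :
    sliceRight f (q • t) = q * sliceRight f t := by
  induction t with
  | zero => simp
  | add v w hv hw => simp only [smul_add, map_add, hv, hw, mul_add]
  | tmul v h => simp [TensorProduct.smul_tmul']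

theorem sliceRight_symbolTensor (f : K →ₗ[k] k) (t : JordanPlane k ⊗[k] K) :
    sliceRight f (symbolTensor k K t) = symbol k (sliceRight f t) := by
  induction t with
  | zero => simp
  | add v w hv hw => simp only [map_add, hv, hw]
  | tmul v h => simp

theorem rTensor_taylor_smul (r : k) (q : k[X]) (t : k[X] ⊗[k] K) :
    (taylor r).rTensor K (q • t) = taylor r q • (taylor r).rTensor K t := by
  induction t with
  | zero => simp
  | add v w hv hw => simp only [smul_add, map_add, hv, hw]
  | tmul v h => simp [TensorProduct.smul_tmul', taylor_mul]

theorem rTensor_taylor_taylor (r s : k) (t : k[X] ⊗[k] K) :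
    (taylor r).rTensor K ((taylor s).rTensor K t) = (taylor (r + s)).rTensor K t := by
  induction t with
  | zero => simp
  | add v w hv hw => simp only [map_add, hv, hw]
  | tmul v h => simp [taylor_taylor]

theorem map_taylor_smul (φ : K →ₗ[k] K) (r : k) (q : k[X]) (t : k[X] ⊗[k] K) :
    TensorProduct.map (taylor r) φ (q • t) = taylor r q • TensorProduct.map (taylor r) φ t := by
  induction t with
  | zero => simp
  | add v w hv hw => simp only [smul_add, map_add, hv, hw]
  | tmul v h => simp [TensorProduct.smul_tmul', taylor_mul]

end HomogeneousTensor

/-! ### Polynomial relations among the symbols of the coaction. -/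

section Relations

variable {k : Type*} [Field k] {K : Type*} [Ring K] [Algebra k K]

/-- The symbol of the coaction on the homogeneous element of degree `m` with symbol `f`. -/
noncomputable def coactionSymbol (ρ : JordanPlane k →ₐ[k] JordanPlane k ⊗[k] K) (m : ℕ) :
    k[X] →ₗ[k] k[X] ⊗[k] K :=
  symbolTensor k K ∘ₗ ρ.toLinearMap ∘ₗ ofSymbol k m

/-- The linear combination `∑ Qᵢ • ω (X ^ i)`, where `ω` is the symbol of the coaction in
degree `m`. -/
noncomputable def relationMap (ρ : JordanPlane k →ₐ[k] JordanPlane k ⊗[k] K) (m : ℕ) :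
    k[X][X] →ₗ[k[X]] k[X] ⊗[k] K :=
  Polynomial.lsum fun i => LinearMap.toSpanSingleton k[X] _ (coactionSymbol ρ m (X ^ i))

variable (ρ : JordanPlane k →ₐ[k] JordanPlane k ⊗[k] K) (m : ℕ)

theorem relationMap_C_mul_X_pow (q : k[X]) (i : ℕ) :
    relationMap ρ m (C q * X ^ i) = q • coactionSymbol ρ m (X ^ i) := by
  rw [C_mul_X_pow_eq_monomial, relationMap, lsum_apply, sum_monomial_index] <;> simp

theorem relationMap_C (q : k[X]) :
    relationMap ρ m (C q) = q • coactionSymbol ρ m 1 := by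
  simpa using relationMap_C_mul_X_pow ρ m q 0

theorem relationMap_C_mul_map_C (q f : k[X]) :
    relationMap ρ m (C q * f.map C) = q • coactionSymbol ρ m f := by
  induction f using Polynomial.induction_on' with
  | add f g hf hg => rw [Polynomial.map_add, mul_add, map_add, hf, hg, map_add, smul_add]
  | monomial n a =>
    rw [← C_mul_X_pow_eq_monomial, Polynomial.map_mul, map_C, Polynomial.map_pow, map_X,
      ← mul_assoc, ← C_mul, relationMap_C_mul_X_pow, ← smul_eq_C_mul, map_smul, mul_comm,
      ← smul_eq_C_mul]
    rw [smul_assoc, smul_comm]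

theorem relationMap_eq_sum {Q : k[X][X]} {n : ℕ} (hQ : Q.natDegree < n) :
    relationMap ρ m Q = ∑ i ∈ Finset.range n, Q.coeff i • coactionSymbol ρ m (X ^ i) := by
  conv_lhs => rw [Q.as_sum_range' n hQ, map_sum]
  exact Finset.sum_congr rfl fun i _ => by
    rw [← C_mul_X_pow_eq_monomial, relationMap_C_mul_X_pow]

/-- Makes the relations in `Y`-degree at most `m` stable under the double shift: `X` moves in the
coefficients, `Y` in the arguments of the coaction. -/
theorem relationMap_doubleShift {φ : K →ₐ[k] K}
    (hφ : ∀ u, Algebra.TensorProduct.map (shear k) φ (ρ u) = ρ (shear k u))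
    {Q : k[X][X]} (hQ : Q.natDegree ≤ m) :
    relationMap ρ m (doubleShift Q) =
      TensorProduct.map (taylor 2) φ.toLinearMap (relationMap ρ m Q) := by
  have hE : ∀ t, symbolTensor k K (Algebra.TensorProduct.map (shear k) φ t) =
      TensorProduct.map (taylor 2) φ.toLinearMap (symbolTensor k K t) := by
    intro t
    induction t with
    | zero => simp
    | add v w hv hw => simp only [map_add, hv, hw]
    | tmul v h => simp [symbol_shear]
  have hω : ∀ f : k[X], f.natDegree ≤ m → coactionSymbol ρ m (taylor 2 f) =
      TensorProduct.map (taylor 2) φ.toLinearMap (coactionSymbol ρ m f) := by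
    intro f hf
    simp only [coactionSymbol, LinearMap.comp_apply, AlgHom.toLinearMap_apply]
    rw [← shear_ofSymbol hf, ← hφ, hE]
  have hsum : doubleShift Q = ∑ i ∈ Finset.range (m + 1),
      C (taylor 2 (Q.coeff i)) * ((taylor (2 : k) (X ^ i)).map C : k[X][X]) := by
    conv_lhs => rw [Q.as_sum_range' (m + 1) (Nat.lt_succ_of_le hQ)]
    rw [doubleShift, Polynomial.map_sum, map_sum]
    refine Finset.sum_congr rfl fun i _ => ?_
    rw [← C_mul_X_pow_eq_monomial, Polynomial.map_mul, map_C, Polynomial.map_pow, map_X,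
      taylor_mul, taylor_C, taylor_X_pow, taylor_X_pow, Polynomial.map_pow, Polynomial.map_add,
      map_X, map_C]
    rfl
  rw [hsum, map_sum, relationMap_eq_sum ρ m (Nat.lt_succ_of_le hQ), map_sum]
  refine Finset.sum_congr rfl fun i hi => ?_
  rw [relationMap_C_mul_map_C, map_taylor_smul, hω]
  exact (natDegree_X_pow_le i).trans (Nat.lt_succ_iff.mp (Finset.mem_range.mp hi))

theorem exists_relationMap_eq_zero [FiniteDimensional k K]
    (hm : Module.finrank k K ≤ m) :
    ∃ Q : k[X][X], relationMap ρ m Q = 0 ∧ Q ≠ 0 ∧ Q.natDegree ≤ m := by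
  -- There are `m + 1` vectors in a free `k[X]`-module of rank `dim K ≤ m`.
  have hli : ¬ LinearIndependent k[X]
      (fun i : Fin (m + 1) => coactionSymbol ρ m (X ^ (i : ℕ))) := by
    intro hli
    have h := hli.fintype_card_le_finrank
    rw [Fintype.card_fin, Module.finrank_baseChange] at h
    omega
  obtain ⟨g, hg, i, hi⟩ := Fintype.not_linearIndependent_iff.mp hli
  refine ⟨∑ j : Fin (m + 1), C (g j) * X ^ (j : ℕ), ?_, ?_, ?_⟩
  · rw [map_sum, ← hg]
    exact Finset.sum_congr rfl fun j _ => relationMap_C_mul_X_pow ρ m _ _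
  · intro h0
    have := congrArg (fun Q => Q.coeff (i : ℕ)) h0
    simp only [finsetSum_coeff, coeff_C_mul, coeff_X_pow, coeff_zero, mul_ite, mul_one,
      mul_zero, Fin.val_inj, Finset.sum_ite_eq, Finset.mem_univ, if_true] at this
    exact hi this
  · refine natDegree_sum_le_of_forall_le _ _ fun j _ => ?_
    exact (natDegree_C_mul_X_pow_le _ _).trans (Nat.lt_succ_iff.mp j.2)

end Relations

end JordanPlane

namespace JordanPlane

/-! ### Semi-invariants, and the comatrix is scalar. -/

section Semiinvariant

variable {k : Type*} [Field k] {K : Type*} [Ring K] [HopfAlgebra k K]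

theorem apply_sliceLeft {A : Type*} [AddCommGroup A] [Module k A] (e : A →ₗ[k] k)
    (f : K →ₗ[k] k) (t : A ⊗[k] K) : f (sliceLeft e t) = e (sliceRight f t) := by
  induction t with
  | zero => simp
  | add v w hv hw => simp only [map_add, hv, hw]
  | tmul v h => simp [mul_comm]

theorem sliceRight_counit {ρ : JordanPlane k →ₐ[k] JordanPlane k ⊗[k] K}
    (hρ : IsRightComoduleAlgebra ρ) (u : JordanPlane k) :
    sliceRight (Coalgebra.counit (R := k)) (ρ u) = u := hρ.counit u

theorem shear_coaction {ρ : JordanPlane k →ₐ[k] JordanPlane k ⊗[k] K} {a b c d : K}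
    (h0 : ρ (gen k 0) = gen k 0 ⊗ₜ[k] a + gen k 1 ⊗ₜ[k] c)
    (h1 : ρ (gen k 1) = gen k 0 ⊗ₜ[k] b + gen k 1 ⊗ₜ[k] d)
    {φ : K →ₐ[k] K} (ha : φ a = a - 2 * c) (hc : φ c = c) (hd : φ d = d + 2 * c)
    (hb : φ b = b + 2 * a - 2 * d - 4 * c) (u : JordanPlane k) :
    Algebra.TensorProduct.map (shear k) φ (ρ u) = ρ (shear k u) := by
  have two : ∀ v : K, 2 * v = (2 : k) • v := fun v => by rw [two_mul, two_smul]
  have four : ∀ v : K, 4 * v = (4 : k) • v := fun v => by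
    rw [show (4 : K) = 2 * 2 by norm_num, mul_assoc, two, two, smul_smul]
    norm_num
  have : (Algebra.TensorProduct.map (shear k) φ).comp ρ = ρ.comp (shear k) := by
    apply algHom_ext
    · simp only [AlgHom.comp_apply, h0, map_add, Algebra.TensorProduct.map_tmul, shear_gen_zero,
        shear_gen_one, ha, hc, two]
      simp only [TensorProduct.tmul_sub, TensorProduct.add_tmul, TensorProduct.tmul_smul,
        ← TensorProduct.smul_tmul']
      abel
    · simp only [AlgHom.comp_apply, h0, h1, map_add, Algebra.TensorProduct.map_tmul,
        shear_gen_zero, shear_gen_one, hb, hd, two, four, map_smul]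
      simp only [TensorProduct.tmul_sub, TensorProduct.tmul_add, TensorProduct.add_tmul,
        TensorProduct.tmul_smul, ← TensorProduct.smul_tmul']
      module
  exact DFunLike.congr_fun this u

variable [CharZero k] [FiniteDimensional k K]

/-- In some positive degree, the elements with symbols `1` and `X` are semi-invariants of a common
weight. -/
theorem exists_semiinvariant {ρ : JordanPlane k →ₐ[k] JordanPlane k ⊗[k] K}
    (hρ : IsRightComoduleAlgebra ρ) {a b c d : K}
    (h0 : ρ (gen k 0) = gen k 0 ⊗ₜ[k] a + gen k 1 ⊗ₜ[k] c)
    (h1 : ρ (gen k 1) = gen k 0 ⊗ₜ[k] b + gen k 1 ⊗ₜ[k] d) :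
    ∃ (l : ℕ) (g : K), 0 < l ∧ ρ (ofSymbol k l 1) = ofSymbol k l 1 ⊗ₜ g ∧
      ρ (ofSymbol k l X) = ofSymbol k l X ⊗ₜ g := by
  obtain ⟨φ, ha, hc, hd, hb⟩ := (isJordanComatrix_of_coaction hρ h0 h1).exists_algHom
  have hΦ := shear_coaction h0 h1 ha hc hd hb
  set m := Module.finrank k K with hm
  obtain ⟨e, P, hPN, hP1, hPdeg, hem, ⟨r, hr⟩, huniq⟩ :=
    exists_monic_generator (LinearMap.ker (relationMap ρ m)) m
      (by
        intro q hq
        rw [LinearMap.mem_ker, relationMap_C] at hq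
        have h := congrArg (sliceRight (Coalgebra.counit (R := k))) hq
        rwa [sliceRight_smul, coactionSymbol, LinearMap.comp_apply, LinearMap.comp_apply,
          AlgHom.toLinearMap_apply, sliceRight_symbolTensor, sliceRight_counit hρ,
          symbol_ofSymbol, mul_one, map_zero] at h)
      (exists_relationMap_eq_zero ρ m le_rfl)
      (by
        intro Q hQ hQm
        rw [LinearMap.mem_ker] at hQ ⊢
        rw [relationMap_doubleShift ρ m hΦ hQm, hQ, map_zero])
  obtain ⟨i₀, hi₀, hi₀l⟩ := Finset.exists_mem_eq_sup (Finset.range (e + 2)) ⟨0, by simp⟩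
    (fun i => (P.coeff i).natDegree)
  -- The least degree in which all coefficients of `P` can be homogenized; minimality is what later
  -- forces `η` to be constant.
  set l := (Finset.range (e + 2)).sup (fun i => (P.coeff i).natDegree) with hl
  have hle : ∀ i ∈ Finset.range (e + 2), (P.coeff i).natDegree ≤ l := fun i hi =>
    Finset.le_sup (f := fun i => (P.coeff i).natDegree) hi
  have he0 : (e : k) + 1 ≠ 0 := by exact_mod_cast e.succ_ne_zero
  have hl0 : 0 < l := by
    refine lt_of_lt_of_le ?_ (hle e (by simp))
    rw [hr, natDegree_sub, natDegree_sub_C, natDegree_C_mul_X _ he0]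
    exact one_pos
  -- Left multiplication by degree `l` shifts the other factor by `-l`, so the coefficients are
  -- shifted likewise and the whole relation becomes a translate of that of `P`.
  let p : ℕ → JordanPlane k := fun i => ofSymbol k l (taylor (-(l : k)) (P.coeff i))
  let u : ℕ → JordanPlane k := fun i => ofSymbol k m (X ^ i)
  have hp : ∀ i ∈ Finset.range (e + 2), p i ∈ homogeneous k l := fun i hi =>
    ofSymbol_mem (by rw [natDegree_taylor]; exact hle i hi)
  have hu : ∀ i ∈ Finset.range (e + 2), u i ∈ homogeneous k m := fun i hi =>
    ofSymbol_mem ((natDegree_X_pow_le i).trans (by have := Finset.mem_range.mp hi; omega))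
  have hsymbol : ∀ q : ℕ → JordanPlane k, (∀ i ∈ Finset.range (e + 2), q i ∈ homogeneous k l) →
      symbolTensor k K (∑ i ∈ Finset.range (e + 2), (q i ⊗ₜ[k] (1 : K)) * ρ (u i)) =
        (taylor (-(l : k))).rTensor K (relationMap ρ m (∑ i ∈ Finset.range (e + 2),
          C (taylor (l : k) (symbol k (q i))) * X ^ i)) := by
    intro q hq
    rw [map_sum, map_sum, map_sum]
    refine Finset.sum_congr rfl fun i hi => ?_
    rw [relationMap_C_mul_X_pow, symbolTensor_tmul_one_mul (hq i hi), rTensor_taylor_smul,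
      taylor_taylor, neg_add_cancel, taylor_zero]
    rfl
  have hPsum : P = ∑ i ∈ Finset.range (e + 2), C (P.coeff i) * X ^ i := by
    conv_lhs => rw [P.as_sum_range' (e + 2) (by omega)]
    simp only [C_mul_X_pow_eq_monomial]
  have hzero : ∑ i ∈ Finset.range (e + 2), (p i ⊗ₜ[k] (1 : K)) * ρ (u i) = 0 := by
    refine eq_zero_of_symbolTensor_eq_zero (d := l + m) (Submodule.sum_mem _ fun i hi =>
      tmul_one_mul_mem (hp i hi) (map_mem_homogeneousTensor h0 h1 (hu i hi))) ?_
    rw [hsymbol p hp]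
    have : ∑ i ∈ Finset.range (e + 2), C (taylor (l : k) (symbol k (p i))) * X ^ i = P := by
      rw [hPsum]
      refine Finset.sum_congr rfl fun i _ => ?_
      rw [symbol_ofSymbol, taylor_taylor, add_neg_cancel, taylor_zero]
    rw [this, LinearMap.mem_ker.mp hPN, map_zero]
  have hweight : ∀ f : K →ₗ[k] k, ∃ χ : k, ∀ i ∈ Finset.range (e + 2),
      sliceRight f (ρ (p i)) = χ • p i := by
    intro f
    have hmem : ∀ i ∈ Finset.range (e + 2), sliceRight f (ρ (p i)) ∈ homogeneous k l :=
      fun i hi => sliceRight_mem (map_mem_homogeneousTensor h0 h1 (hp i hi)) f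
    have hf := sum_sliceRight_mul_eq_zero hρ (Finset.range (e + 2)) p u hzero f
    set Q : k[X][X] := ∑ i ∈ Finset.range (e + 2),
      C (taylor (l : k) (symbol k (sliceRight f (ρ (p i))))) * X ^ i with hQ
    have hQN : Q ∈ LinearMap.ker (relationMap ρ m) := by
      have h := congrArg (fun t => (taylor (l : k)).rTensor K (symbolTensor k K t)) hf
      simp only [map_zero] at h
      rw [hsymbol _ hmem, rTensor_taylor_taylor, add_neg_cancel, taylor_zero',
        LinearMap.rTensor_id, LinearMap.id_apply] at h
      exact h
    have hQcoeff : ∀ i ∈ Finset.range (e + 2),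
        Q.coeff i = taylor (l : k) (symbol k (sliceRight f (ρ (p i)))) := by
      intro i hi
      rw [hQ, finsetSum_coeff]
      simp only [coeff_C_mul, coeff_X_pow, mul_ite, mul_one, mul_zero]
      rw [Finset.sum_ite_eq, if_pos hi]
    have hQdeg : Q.natDegree ≤ e + 1 := natDegree_sum_le_of_forall_le _ _ fun i hi =>
      (natDegree_C_mul_X_pow_le _ _).trans (Nat.lt_succ_iff.mp (Finset.mem_range.mp hi))
    have hQP := huniq Q hQN hQdeg
    set η := Q.coeff (e + 1) with hη
    have hcoeff : ∀ i, Q.coeff i = η * P.coeff i := fun i => by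
      conv_lhs => rw [hQP, coeff_C_mul]
    -- The coefficient of `P` at `i₀` already has degree `l`, the largest allowed in `Q`.
    have hηdeg : η.natDegree = 0 := by
      by_cases h0 : η = 0
      · rw [h0, natDegree_zero]
      · have hPi : P.coeff i₀ ≠ 0 := by
          intro hz
          simp only [hz, natDegree_zero] at hi₀l
          omega
        have h2 : (Q.coeff i₀).natDegree ≤ l := by
          rw [hQcoeff i₀ hi₀, natDegree_taylor]
          exact natDegree_symbol_le (hmem i₀ hi₀)
        rw [hcoeff, natDegree_mul h0 hPi] at h2
        omega
    refine ⟨η.coeff 0, fun i hi => symbol_injOn (hmem i hi)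
      (Submodule.smul_mem _ _ (hp i hi)) (taylor_injective (l : k) ?_)⟩
    rw [← hQcoeff i hi, hcoeff, map_smul, map_smul, symbol_ofSymbol, taylor_taylor,
      add_neg_cancel, taylor_zero, smul_eq_C_mul, ← eq_C_of_natDegree_eq_zero hηdeg]
  have hp1 : p (e + 1) = ofSymbol k l 1 := by
    simp only [p, hP1, taylor_one, C_1]
  let ev : JordanPlane k →ₗ[k] k := leval 0 ∘ₗ symbol k
  set g := sliceLeft ev (ρ (ofSymbol k l 1)) with hg
  have hχ : ∀ f : K →ₗ[k] k, ∀ i ∈ Finset.range (e + 2),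
      sliceRight f (ρ (p i)) = f g • p i := by
    intro f i hi
    obtain ⟨χ, hχ⟩ := hweight f
    have : f g = χ := by
      rw [hg, apply_sliceLeft, ← hp1, hχ (e + 1) (by simp), hp1]
      simp [ev, symbol_ofSymbol]
    rw [this, hχ i hi]
  have hsemi : ∀ i ∈ Finset.range (e + 2), ρ (p i) = p i ⊗ₜ g := fun i hi =>
    eq_tmul_of_sliceRight fun f => hχ f i hi
  have hone : ρ (ofSymbol k l 1) = ofSymbol k l 1 ⊗ₜ g := by
    rw [← hp1]; exact hsemi (e + 1) (by simp)
  refine ⟨l, g, hl0, hone, ?_⟩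
  -- The symbol of `p e` is `r - (e + 1)(X - l)`, which is solved for `X`.
  have hX : ofSymbol k l X =
      ((e : k) + 1)⁻¹ • ((r + ((e : k) + 1) * l) • ofSymbol k l 1 - p e) := by
    simp only [p]
    rw [← map_smul, ← map_sub, ← map_smul]
    congr 1
    rw [hr, map_sub, taylor_mul, taylor_C, taylor_C, taylor_X, smul_sub, smul_eq_C_mul,
      smul_eq_C_mul, smul_eq_C_mul]
    simp only [map_add, map_mul, map_neg]
    have : (C ((e : k) + 1)⁻¹ : k[X]) * (C (e : k) + C 1) = 1 := by
      rw [← map_add, ← C_mul, inv_mul_cancel₀ he0, C_1]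
    linear_combination (-X) * this
  rw [hX, map_smul, map_sub, map_smul, hone, hsemi e (by simp), ← TensorProduct.smul_tmul',
    TensorProduct.sub_tmul, ← TensorProduct.smul_tmul']

/-- A finite-dimensional Hopf algebra coacting homogeneously on the Jordan plane in characteristic
zero acts through scalars on the generators. -/
theorem comatrix_eq_scalar {ρ : JordanPlane k →ₐ[k] JordanPlane k ⊗[k] K}
    (hρ : IsRightComoduleAlgebra ρ) {a b c d : K}
    (h0 : ρ (gen k 0) = gen k 0 ⊗ₜ[k] a + gen k 1 ⊗ₜ[k] c)
    (h1 : ρ (gen k 1) = gen k 0 ⊗ₜ[k] b + gen k 1 ⊗ₜ[k] d) : b = 0 ∧ c = 0 ∧ d = a := by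
  obtain ⟨l, g, hl, hone, hX⟩ := exists_semiinvariant hρ h0 h1
  have hmem1 : ofSymbol k l 1 ∈ homogeneous k l := ofSymbol_mem (by simp)
  have hmemX : ofSymbol k l X ∈ homogeneous k l := ofSymbol_mem (natDegree_X_le.trans hl)
  let ev : ℕ → JordanPlane k →ₗ[k] k := fun n => lcoeff k n ∘ₗ symbol k
  have hev1 : ev 0 (ofSymbol k l 1) = 1 := by simp [ev, symbol_ofSymbol]
  have hgl : IsGroupLikeElem k g := by
    constructor
    · have h := congrArg (ev 0) (hρ.counit (ofSymbol k l 1))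
      rw [AlgHom.toLinearMap_apply, hone, LinearMap.lTensor_tmul, TensorProduct.rid_tmul,
        map_smul, hev1] at h
      simpa using h
    · have h := congrArg (sliceLeft (ev 0)) (hρ.coassoc (ofSymbol k l 1))
      rw [AlgHom.toLinearMap_apply, hone, LinearMap.rTensor_tmul, AlgHom.toLinearMap_apply,
        hone, LinearMap.lTensor_tmul, TensorProduct.assoc_tmul, sliceLeft_tmul, sliceLeft_tmul,
        hev1, one_smul, one_smul] at h
      exact h.symm
  obtain ⟨n, rfl⟩ := Nat.exists_eq_succ_of_ne_zero hl.ne'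
  have hone' : ofSymbol k (n + 1) 1 = gen k 0 * gen k 0 ^ n := by
    rw [← pow_zero X, ofSymbol_X_pow, powElem, one_mul, Nat.sub_zero, pow_succ']
  have hX' : ofSymbol k (n + 1) X = (gen k 1 + gen k 0) * gen k 0 ^ n := by
    rw [← pow_one X, ofSymbol_X_pow, powElem, powElem, one_mul, Nat.add_sub_cancel]
    simp
  -- Both semi-invariants have weight `g`, so applying `ρ` here leaves `g` to the left of the
  -- comatrix entries on one side and to their right on the other.
  have hcomm1 : ofSymbol k (n + 1) X * gen k 0 =
      (gen k 1 + gen k 0) * ofSymbol k (n + 1) 1 := by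
    rw [hone', hX', mul_assoc, ← pow_succ, ← pow_succ']
  have hcomm2 : ofSymbol k (n + 1) 1 * gen k 0 = gen k 0 * ofSymbol k (n + 1) 1 := by
    rw [hone', mul_assoc, ← pow_succ, pow_succ']
  have e1 := congrArg (fun t => symbolTensor k K (ρ t)) hcomm1
  have e2 := congrArg (fun t => symbolTensor k K (ρ t)) hcomm2
  simp only [map_mul, map_add, hone, hX, h0, h1, add_mul, mul_add,
    Algebra.TensorProduct.tmul_mul_tmul, symbolTensor_tmul, symbol_mul hmem1, symbol_mul hmemX,
    symbol_mul (gen_mem_homogeneous (k := k) _), symbol_ofSymbol, symbol_gen_zero,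
    symbol_gen_one, taylor_one, C_1, mul_one, one_mul, map_sub, taylor_X] at e1 e2
  have hcancel : ∀ v w : K, v * g = w * g → v = w := fun v w h => by
    have := congrArg (· * HopfAlgebra.antipode k g) h
    simpa only [mul_assoc, hgl.mul_antipode_cancel, mul_one] using this
  have hcancel' : ∀ v : K, g * v = 0 → v = 0 := fun v h => by
    have := congrArg (HopfAlgebra.antipode k g * ·) h
    simpa only [← mul_assoc, hgl.antipode_mul_cancel, one_mul, mul_zero] using this
  -- The coefficients give `g c = 0`, then `g a = d g` and `b g = d g - a g`; `s0` gives `g a = a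
  -- g`. Since `g` is invertible, the entries are determined.
  have q2 := congrArg (sliceLeft (lcoeff k 2)) e1
  have q1 := congrArg (sliceLeft (lcoeff k 1)) e1
  have q0 := congrArg (sliceLeft (leval (0 : k))) e1
  have s0 := congrArg (sliceLeft (leval (1 : k))) e2
  simp [coeff_X, coeff_one] at q2 q1 q0 s0
  have hc := hcancel' c q2
  subst hc
  simp only [mul_zero, zero_mul, smul_zero, add_zero, neg_zero] at q1 q0 s0
  have hda : d = a := hcancel d a (by rw [← q1, s0])
  subst hda
  refine ⟨hcancel b 0 ?_, rfl, rfl⟩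
  rw [zero_mul, q0]
  abel

end Semiinvariant

end JordanPlane

/-! ### Hopf algebras generated by one group-like element. -/

section GroupAlgebra

variable {k K : Type*} [Field k] [Ring K] [HopfAlgebra k K] [FiniteDimensional k K]

variable (k K) in
theorem finite_groupLike : Finite (GroupLike k K) :=
  (linearIndep_groupLikeVal (R := k) (A := K)).finite

theorem isHopfSubalgebra_adjoin_groupLike (g : GroupLike k K) :
    IsHopfSubalgebra (Algebra.adjoin k {(g : K)}) := by
  set B := Algebra.adjoin k {(g : K)} with hB
  have hg : (g : K) ∈ B := Algebra.self_mem_adjoin_singleton k _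
  constructor
  · intro b hb
    change Coalgebra.comul b ∈ (Algebra.TensorProduct.map B.val B.val).range
    induction hb using Algebra.adjoin_induction with
    | mem x hx =>
      obtain rfl : x = g := hx
      rw [g.2.comul_eq_tmul_self]
      exact ⟨(⟨g, hg⟩ : B) ⊗ₜ ⟨g, hg⟩, by simp⟩
    | algebraMap r =>
      rw [Bialgebra.comul_algebraMap]
      exact Subalgebra.algebraMap_mem _ r
    | add x y _ _ hx hy => rw [map_add]; exact add_mem hx hy
    | mul x y _ _ hx hy => rw [Bialgebra.comul_mul]; exact mul_mem hx hy
  · intro b hb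
    induction hb using Algebra.adjoin_induction with
    | mem x hx =>
      obtain rfl : x = g := hx
      have := finite_groupLike k K
      -- Finite order makes `g⁻¹`, which is the antipode of `g`, a nonnegative power of `g`.
      obtain ⟨n, hn⟩ := (isOfFinOrder_of_finite g).mem_powers_iff_mem_zpowers.mpr
        (Subgroup.inv_mem _ (Subgroup.mem_zpowers g))
      have : HopfAlgebra.antipode k (g : K) = (g : K) ^ n := by
        rw [← GroupLike.val_inv, ← GroupLike.val_pow]
        exact congrArg GroupLike.val hn.symm
      rw [this]
      exact pow_mem hg n
    | algebraMap r =>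
      rw [Algebra.algebraMap_eq_smul_one, map_smul, HopfAlgebra.antipode_one]
      exact Subalgebra.smul_mem _ (one_mem _) r
    | add x y _ _ hx hy => rw [map_add]; exact add_mem hx hy
    | mul x y _ _ hx hy =>
      rw [HopfAlgebra.antipode_mul_antidistrib]
      exact mul_mem hy hx

/-- A finite-dimensional Hopf algebra generated by a group-like element is the group algebra of a
finite cyclic group. -/
theorem exists_bialgEquiv_of_adjoin_groupLike (g : GroupLike k K)
    (hg : Algebra.adjoin k {(g : K)} = ⊤) :
    ∃ n : ℕ, 0 < n ∧ Nonempty (K ≃ₐc[k] MonoidAlgebra k (Multiplicative (ZMod n))) := by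
  have := finite_groupLike k K
  let e := zmodCyclicMulEquiv (G := Subgroup.zpowers g) inferInstance
  let ψ : Multiplicative (ZMod (Nat.card (Subgroup.zpowers g))) →* GroupLike k K :=
    (Subgroup.zpowers g).subtype.comp e.toMonoidHom
  have hψ : Function.Injective ψ := Subtype.val_injective.comp e.injective
  let F : MonoidAlgebra k (Multiplicative (ZMod (Nat.card (Subgroup.zpowers g)))) →ₐc[k] K :=
    MonoidAlgebra.liftGroupLikeBialgHom.comp (MonoidAlgebra.mapDomainBialgHom k ψ)
  have hF : ∀ i, F (MonoidAlgebra.single i 1) = (ψ i : K) := by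
    intro i
    simp [F]
  have hlin : ∀ x, F x = Finsupp.linearCombination k (fun i => (ψ i : K)) x.coeff := by
    intro x
    induction x using MonoidAlgebra.induction_linear with
    | zero => simp
    | add x y hx hy => rw [map_add, hx, hy, MonoidAlgebra.coeff_add, map_add]
    | single i r =>
      rw [← mul_one r, ← smul_eq_mul, ← MonoidAlgebra.smul_single, map_smul, hF]
      simp
  -- Distinct group-like elements are linearly independent.
  have hinj : Function.Injective F := by
    intro x y hxy
    rw [hlin, hlin] at hxy
    exact MonoidAlgebra.coeff_injective
      ((linearIndep_groupLikeVal (R := k) (A := K)).comp ψ hψ hxy)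
  have hsurj : Function.Surjective F := by
    have h : Algebra.adjoin k {(g : K)} ≤ (AlgHomClass.toAlgHom F).range := by
      rw [Algebra.adjoin_le_iff, Set.singleton_subset_iff]
      refine ⟨MonoidAlgebra.single (e.symm ⟨g, Subgroup.mem_zpowers g⟩) 1, ?_⟩
      refine (hF _).trans ?_
      simp [ψ]
    rw [hg] at h
    intro v
    exact h (Algebra.mem_top (x := v))
  exact ⟨_, Nat.card_pos, ⟨(BialgEquiv.ofBijective F ⟨hinj, hsurj⟩).symm⟩⟩

end GroupAlgebra

end

theorem proposition5p9 {k K : Type*} [Field k] [CharZero k]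
    [Ring K] [HopfAlgebra k K] [FiniteDimensional k K]
    (ρ : JordanPlane k →ₐ[k] JordanPlane k ⊗[k] K)
    (hρ : IsRightComoduleAlgebra ρ)
    (hdeg : ∃ a : Matrix (Fin 2) (Fin 2) K, ∀ i : Fin 2,
      ρ (JordanPlane.gen k i) =
        JordanPlane.gen k 0 ⊗ₜ[k] a 0 i + JordanPlane.gen k 1 ⊗ₜ[k] a 1 i)
    (hfaithful : IsInnerFaithfulCoaction ρ.toLinearMap) :
    ∃ n : ℕ, 0 < n ∧ Nonempty (K ≃ₐc[k] MonoidAlgebra k (Multiplicative (ZMod n))) := by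
  obtain ⟨a, ha⟩ := hdeg
  obtain ⟨hb, hc, hd⟩ := JordanPlane.comatrix_eq_scalar hρ (ha 0) (ha 1)
  have hM := isJordanComatrix_of_coaction hρ (ha 0) (ha 1)
  let g : GroupLike k K := ⟨a 0 0, hM.counit_a, by rw [hM.comul_a, hb, TensorProduct.zero_tmul,
    add_zero]⟩
  have hB := isHopfSubalgebra_adjoin_groupLike g
  refine exists_bialgEquiv_of_adjoin_groupLike g ?_
  by_contra hne
  refine hfaithful _ hB hne ?_
  set B := Algebra.adjoin k {(g : K)}
  have hgB : a 0 0 ∈ B := Algebra.self_mem_adjoin_singleton k _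
  rintro _ ⟨u, rfl⟩
  -- Written as the range of an algebra map, the target is a subalgebra, so the generators suffice.
  change ρ u ∈ (Algebra.TensorProduct.map (AlgHom.id k (JordanPlane k)) B.val).range
  induction u using JordanPlane.induction with
  | algebraMap r => rw [AlgHom.commutes]; exact Subalgebra.algebraMap_mem _ r
  | gen i =>
    refine ⟨JordanPlane.gen k i ⊗ₜ ⟨a 0 0, hgB⟩, ?_⟩
    fin_cases i
    · simp [ha, hc]
    · simp [ha, hb, hd]
  | add u v hu hv => rw [map_add]; exact add_mem hu hv
  | mul u v hu hv => rw [map_mul]; exact mul_mem hu hv
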